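/- Let $\mathcal G$ be the group (under composition) of polynomial automorphisms $\sigma=(f,g)$, $f,g\in\mathbb C[X,Y]$, of the complex affine plane, with $\deg\sigma=\max(\deg f,\deg g)$. An automorphism is affine if it has degree $1$, and triangular if it has the form $(rX+P(Y),\,sY+t)$ with $r,s\in\mathbb C^*$, $t\in\mathbb C$, $P\in\mathbb C[Y]$. A degree sequence is a finite, possibly empty, sequence of integers $\ge 2$. For a degree sequence $d=(d_1,\dots,d_l)$ let $\mathcal G_d$ be the set of automorphisms of polydegree $d$, that is, of the form $\alpha_0\beta_1\alpha_1\beta_2\alpha_2\cdots\beta_l\alpha_l$ with all $\alpha_i$ affine, each $\beta_i$ triangular of degree $d_i$, and $\alpha_1,\dots,\alpha_{l-1}$ not triangular. Give $\mathcal G$ its Zariski topology as an infinite-dimensional variety: a set $F\subset\mathcal G$ is closed if and only if, for every $n$, the set of $\sigma\in F$ with $\deg\sigma\le n$ is defined inside $\{\sigma\in\mathcal G:\deg\sigma\le n\}$ by polynomial equations in the coefficients of $\sigma$. Write $d\sqsubseteq e$ if $\mathcal G_d\subset\overline{\mathcal G_e}$. Let $\preceq$ be Furter's order on degree sequences, that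 is, the reflexive transitive relation generated by: $\emptyset\preceq e$; $(d_1,\dots,d_l)\preceq(e_1,\dots,e_l)$ if $d_i\le e_i$ for all $i$; and $(u,\,p+q-1,\,v)\preceq(u,\,p,\,q,\,v)$ for consecutive entries $p,q$ and arbitrary sequences $u,v$. For $n,p,q,r\ge2$ it satisfies $(n)\preceq(p,q)$ if and only if $n\le p+q-1$, and $(n)\preceq(p,q,r)$ if and only if $n\le p+q+r-2$. **Main Theorem.** (1) Let $a,b\ge 2$ and $c\ge 1$ be integers and set $d=ab-1$. Then $$\mathcal G_{(cd+a)}\subset\overline{\mathcal G_{(cd-1,\,b,\,a)}}.$$ In particular, every triangular automorphism of degree $cd+a$ lies in $\overline{\mathcal G_{(cd-1,b,a)}}$. (2) For all integers $a\ge 2$ and $c\ge 1$ one has $(c(2a-1)+a)\sqsubseteq(c(2a-1)-1,\,2,\,a)$ but $(c(2a-1)+a)\not\preceq(c(2a-1)-1,\,2,\,a)$. Hence the relations $\sqsubseteq$ and $\preceq$ on degree sequences do not coincide, contrary to Furter's conjecture. More generally, $\sqsubseteq$ does not coincide with any relation $R$ on degree sequences such that, for all $n,p,q,r\ge 2$,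 $R\big((n),(p,q,r)\big)$ holds if and only if $n\le p+q+r-2$. -/

import Mathlib

/-- The group of polynomial automorphisms of the complex affine plane. An automorphism is given by
the comorphism, a `ℂ`-algebra automorphism of `ℂ[X, Y]`, where `X = X 0` and `Y = X 1`; the
multiplicative opposite makes the product of the group the composition of maps of the plane. -/
def PlaneAut : Type :=
  (MvPolynomial (Fin 2) ℂ ≃ₐ[ℂ] MvPolynomial (Fin 2) ℂ)ᵐᵒᵖ

namespace PlaneAut

noncomputable instance : Group PlaneAut :=
  inferInstanceAs (Group (MvPolynomial (Fin 2) ℂ ≃ₐ[ℂ] MvPolynomial (Fin 2) ℂ)ᵐᵒᵖ)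

/-- The components of an automorphism: `σ = (f, g)` with `f = σ.comp 0` and `g = σ.comp 1`. -/
noncomputable def comp (σ : PlaneAut) (i : Fin 2) : MvPolynomial (Fin 2) ℂ :=
  MulOpposite.unop σ (MvPolynomial.X i)

/-- The product is the composition of polynomial maps: `σ * τ = (f(τ), g(τ))` for `σ = (f, g)`. -/
theorem comp_mul (σ τ : PlaneAut) (i : Fin 2) :
    (σ * τ).comp i = MvPolynomial.aeval τ.comp (σ.comp i) := by
  have h : (MulOpposite.unop τ : MvPolynomial (Fin 2) ℂ ≃ₐ[ℂ] MvPolynomial (Fin 2) ℂ).toAlgHom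
      = MvPolynomial.aeval τ.comp := by
    apply MvPolynomial.algHom_ext
    intro j
    simp [comp]
  exact DFunLike.congr_fun h (σ.comp i)

/-- Two automorphisms with the same components are equal. -/
theorem ext_comp {σ τ : PlaneAut} (h : ∀ i, σ.comp i = τ.comp i) : σ = τ := by
  apply MulOpposite.unop_injective
  apply AlgEquiv.coe_toAlgHom_injective
  exact MvPolynomial.algHom_ext h

/-- The degree of `σ = (f, g)` is the maximum of the degrees of `f` and `g`. -/
noncomputable def degree (σ : PlaneAut) : ℕ :=
  max (σ.comp 0).totalDegree (σ.comp 1).totalDegree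

/-- Affine automorphisms: those of degree `1`. -/
def IsAffine (σ : PlaneAut) : Prop :=
  σ.degree = 1

/-- Triangular automorphisms: those of the form `(r X + P(Y), s Y + t)` with `r, s ≠ 0`. -/
def IsTriangular (σ : PlaneAut) : Prop :=
  ∃ (r s t : ℂ) (P : Polynomial ℂ), r ≠ 0 ∧ s ≠ 0 ∧
    σ.comp 0 = MvPolynomial.C r * MvPolynomial.X 0 + Polynomial.aeval (MvPolynomial.X 1) P ∧
    σ.comp 1 = MvPolynomial.C s * MvPolynomial.X 1 + MvPolynomial.C t

/-- The coefficients of the two components, as a point of an affine space (with one coordinate for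
each component and each monomial). -/
noncomputable def coeffs (σ : PlaneAut) : Fin 2 × (Fin 2 →₀ ℕ) → ℂ :=
  fun p => (σ.comp p.1).coeff p.2

/-- The Zariski topology on the set of automorphisms of degree at most `n`: the topology induced by
the Zariski topology of the affine space of coefficients. The coordinates belonging to monomials of
degree greater than `n` vanish on this set, so that only finitely many coordinates matter. -/
@[reducible]
noncomputable def zariskiLE (n : ℕ) : TopologicalSpace {σ : PlaneAut // σ.degree ≤ n} :=
  TopologicalSpace.induced (fun σ => MvPolynomial.pointToPoint σ.1.coeffs)
    (inferInstance : TopologicalSpace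
      (PrimeSpectrum (MvPolynomial (Fin 2 × (Fin 2 →₀ ℕ)) ℂ)))

/-- The Zariski topology of the infinite-dimensional variety of automorphisms: a set is closed if
and only if for every `n` its trace on the automorphisms of degree at most `n` is closed. -/
noncomputable instance : TopologicalSpace PlaneAut :=
  ⨆ n : ℕ, TopologicalSpace.coinduced Subtype.val (zariskiLE n)

/-- The closed sets are those that are cut out, in each bounded degree, by polynomial equations in
the coefficients. -/
theorem isClosed_iff (F : Set PlaneAut) :
    IsClosed F ↔ ∀ n : ℕ, ∃ S : Set (MvPolynomial (Fin 2 × (Fin 2 →₀ ℕ)) ℂ),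
      ∀ σ : PlaneAut, σ.degree ≤ n → (σ ∈ F ↔ ∀ p ∈ S, MvPolynomial.eval σ.coeffs p = 0) := by
  have key : ∀ (S : Set (MvPolynomial (Fin 2 × (Fin 2 →₀ ℕ)) ℂ)) (x : Fin 2 × (Fin 2 →₀ ℕ) → ℂ),
      (MvPolynomial.pointToPoint x : PrimeSpectrum (MvPolynomial (Fin 2 × (Fin 2 →₀ ℕ)) ℂ)) ∈
        PrimeSpectrum.zeroLocus S ↔ ∀ p ∈ S, MvPolynomial.eval x p = 0 := by
    intro S x
    rw [PrimeSpectrum.mem_zeroLocus]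
    simp [MvPolynomial.pointToPoint, Set.subset_def, MvPolynomial.mem_vanishingIdeal_iff,
      MvPolynomial.aeval_eq_eval]
  rw [isClosed_iSup_iff]
  refine forall_congr' fun n => ?_
  rw [isClosed_coinduced, isClosed_induced_iff]
  constructor
  · rintro ⟨t, ht, h⟩
    obtain ⟨S, rfl⟩ := (PrimeSpectrum.isClosed_iff_zeroLocus t).1 ht
    refine ⟨S, fun σ hσ => ?_⟩
    rw [← key]
    exact (Set.ext_iff.1 h ⟨σ, hσ⟩).symm
  · rintro ⟨S, h⟩
    refine ⟨PrimeSpectrum.zeroLocus S, PrimeSpectrum.isClosed_zeroLocus S, ?_⟩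
    ext ⟨σ, hσ⟩
    exact (key S _).trans (h σ hσ).symm

/-- The set of automorphisms of polydegree `d = (d₁, …, d_l)`, where all `d_i ≥ 2`: those that have
a reduced decomposition `α₀ β₁ α₁ β₂ α₂ ⋯ β_l α_l` with `α_i` affine, `β_i` triangular of degree
`d_i`, and `α₁, …, α_{l-1}` not triangular. The list `L` below is `(β₁, α₁), …, (β_l, α_l)`. For the
empty sequence these are the affine automorphisms. -/
def ofPolydegree (d : List ℕ) : Set PlaneAut :=
  {σ | (∀ m ∈ d, 2 ≤ m) ∧
    ∃ (α₀ : PlaneAut) (L : List (PlaneAut × PlaneAut)),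
      α₀.IsAffine ∧
      (∀ p ∈ L, p.1.IsTriangular ∧ p.2.IsAffine) ∧
      L.map (fun p => p.1.degree) = d ∧
      (∀ p ∈ L.dropLast, ¬ p.2.IsTriangular) ∧
      σ = α₀ * (L.map (fun p => p.1 * p.2)).prod}

end PlaneAut

/-- Degree sequences: finite sequences of integers `≥ 2`, including the empty one. -/
def IsDegreeSequence (d : List ℕ) : Prop :=
  ∀ m ∈ d, 2 ≤ m

/-- The order `d ⊑ e`: every automorphism of polydegree `d` is in the Zariski closure of the set of
automorphisms of polydegree `e`. -/
def ClosureLE (d e : List ℕ) : Prop :=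
  PlaneAut.ofPolydegree d ⊆ closure (PlaneAut.ofPolydegree e)

/-- Furter's order `d ⪯ e` on degree sequences: the reflexive and transitive relation generated by
lowering entries, by replacing two consecutive entries `a, b` by the single entry `a + b - 1`, and
by `∅ ⪯ e`. -/
inductive FurterLE : List ℕ → List ℕ → Prop
  | empty (e : List ℕ) : IsDegreeSequence e → FurterLE [] e
  | lower (d e : List ℕ) : IsDegreeSequence d → List.Forall₂ (· ≤ ·) d e → FurterLE d e
  | merge (u v : List ℕ) (a b : ℕ) : IsDegreeSequence (u ++ a :: b :: v) →
      FurterLE (u ++ (a + b - 1) :: v) (u ++ a :: b :: v)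
  | trans {d e f : List ℕ} : FurterLE d e → FurterLE e f → FurterLE d f

theorem FurterLE.sum_le {d e : List ℕ} (h : FurterLE d e) :
    (d.map (· - 1)).sum ≤ (e.map (· - 1)).sum := by
  induction h with
  | empty e _ => simp
  | lower d e _ h =>
    clear * - h
    induction h with
    | nil => simp
    | cons h _ ih => simp only [List.map_cons, List.sum_cons]; omega
  | merge u v a b h =>
    have ha : 2 ≤ a := h a (by simp)
    have hb : 2 ≤ b := h b (by simp)
    simp only [List.map_append, List.map_cons, List.sum_append, List.sum_cons]
    omega
  | trans _ _ h1 h2 => exact h1.trans h2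

/-- The order on sequences of length `1` and `2`. -/
theorem furterLE_pair_iff {n p q : ℕ} (hn : 2 ≤ n) (hp : 2 ≤ p) (hq : 2 ≤ q) :
    FurterLE [n] [p, q] ↔ n ≤ p + q - 1 := by
  constructor
  · intro h
    have := h.sum_le
    simp at this
    omega
  · intro h
    refine .trans (.lower [n] [p + q - 1] ?_ ?_) (.merge [] [] p q ?_)
    · simpa [IsDegreeSequence] using hn
    · simpa using h
    · simpa [IsDegreeSequence] using ⟨hp, hq⟩

/-- The order on sequences of length `1` and `3`. -/
theorem furterLE_triple_iff {n p q r : ℕ} (hn : 2 ≤ n) (hp : 2 ≤ p) (hq : 2 ≤ q) (hr : 2 ≤ r) :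
    FurterLE [n] [p, q, r] ↔ n ≤ p + q + r - 2 := by
  constructor
  · intro h
    have := h.sum_le
    simp at this
    omega
  · intro h
    refine .trans ((furterLE_pair_iff (p := p + q - 1) hn (by omega) hr).2 (by omega))
      (.merge [] [r] p q ?_)
    simpa [IsDegreeSequence] using ⟨hp, hq, hr⟩

/-!
The closure statement is proved by an explicit one-parameter family that is polynomial in its
parameter `ε`, has polydegree `(cd - 1, b, a)` for almost all `ε ≠ 0`, and takes a prescribed
triangular value of degree `cd + a` at `ε = 0`. Equations in the coefficients that hold for
infinitely many `ε` hold for `ε = 0` (`PlaneAut.mem_closure_of_family`), so this value is in the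
closure.

For a polynomial `A` of degree `a` put `f = ε ^ c X + A(Y)` and `g = Y + ε f ^ b`. Up to terms
divisible by `ε ^ (c + 1)`, `g` is `Y + ε A(Y) ^ b`, and Lagrange inversion writes `A(Y)` as
`∑ ε ^ k C_k(Y + ε A(Y) ^ b)` with `C_k` proportional to the `k`-th derivative of `A ^ (b k + 1)`, of
degree `k d + a`. The terms with `k < c` have degree at most `(c - 1) d + a ≤ cd - 1`. With
`C = ∑_{k < c} ε ^ k C_k`, the polynomial `f - C(g)` is therefore divisible by `ε ^ c`, and
`(f - C(g)) / ε ^ c` tends to `X + C_c(Y)`, of degree `cd + a`, while `g` tends to `Y`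
(`pow_dvd_sub_sum_lagrangeCoeff`). For `ε ≠ 0` the pair `((f - C(g)) / ε ^ c, g)` is the composite of
triangular automorphisms of degrees `a`, `b` and `deg C`, separated by exchanges of the coordinates
(`PlaneAut.exists_mem_ofPolydegree`).

It remains to reach every `P` of degree `cd + a` in place of `C_c`. The coefficients of `P` in the
`a + 1` degrees from `cd` to `cd + a` are obtained by the choice of `A`: up to a constant, `C_c` is
the `c`-th derivative of `A ^ (b c + 1)`, and the `a + 1` leading coefficients of a power of `A` can
be prescribed (`exists_pow_coeff_eq`, `exists_lagrangeCoeff_coeff_eq`). The lower coefficients are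
corrected by adding to `C` a term `ε ^ c D` with `deg D ≤ cd - 1`. Adding `ε ^ (c + 1) T ^ (cd - 1)`
as well gives `C` the exact degree `cd - 1` for almost all `ε`, without effect on the limit.

For `b = 2` the degree `cd + a` is one more than `(cd - 1) + 2 + a - 2`, the largest `n` for which
`(n)` precedes `(cd - 1, 2, a)` in Furter's order.
-/

/-! ### Lagrange inversion modulo a power of the parameter -/

section Lagrange

open Polynomial

/-- The sum is the value at `y = x` of the `m`-th `y`-derivative of `H(y) (G(x) - G(y)) ^ n`, which
vanishes to order `n` along the diagonal. -/
theorem sum_neg_one_pow_mul_iterate_derivative_eq_zero {R : Type*} [CommRing R] (G H : R[X])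
    {m n : ℕ} (h : m < n) :
    ∑ k ∈ Finset.range (n + 1),
      (-1) ^ k * (n.choose k : R[X]) * G ^ (n - k) * derivative^[m] (H * G ^ k) = 0 := by
  -- The inner variable of `R[X][X]` is `x` and the outer one is `y`: `C G` is `G(x)` and `G.map C`
  -- is `G(y)`.
  have h1 : (X - C X : R[X][X]) ∣ C G - G.map C := by
    rw [dvd_iff_isRoot]
    simp [IsRoot, eval_map, eval₂_C_X]
  have h2 : (X - C X : R[X][X]) ∣ derivative^[m] (H.map C * (C G - G.map C) ^ n) := by
    refine dvd_trans ?_ (pow_sub_dvd_iterate_derivative_of_pow_dvd m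
      (Dvd.dvd.mul_left (pow_dvd_pow_of_dvd h1 n) (H.map C)))
    exact dvd_pow_self _ (by omega)
  rw [dvd_iff_isRoot, IsRoot] at h2
  rw [← h2]
  have h3 : H.map C * (C G - G.map C) ^ n = ∑ k ∈ Finset.range (n + 1),
      C ((-1) ^ k * (n.choose k : R[X]) * G ^ (n - k)) * ((H * G ^ k).map C) := by
    rw [sub_eq_neg_add, add_pow, Finset.mul_sum]
    refine Finset.sum_congr rfl fun k _ => ?_
    rw [neg_pow]
    simp only [Polynomial.map_mul, Polynomial.map_pow, map_mul, map_pow, map_neg, map_one,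
      map_natCast]
    ring
  rw [h3, iterate_derivative_sum, eval_finsetSum]
  refine Finset.sum_congr rfl fun k _ => ?_
  rw [iterate_derivative_C_mul, iterate_derivative_map, eval_mul, eval_C, eval_map, eval₂_C_X]

variable {K : Type*} [Field K] [CharZero K]

/-- The coefficient of `ε ^ k` in the expansion of `A(Φ)`, where `Φ` is the inverse under
composition of `T + ε A(T) ^ b`. Lagrange's formula for it is `(-1) ^ k / k!` times the
`(k - 1)`-st derivative of `A' A ^ (b k)`; as `A' A ^ (b k)` is itself a derivative, this is a
multiple of the `k`-th Hasse derivative of `A ^ (b k + 1)`, a form that also makes sense for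
`k = 0`. -/
noncomputable def lagrangeCoeff (A : K[X]) (b k : ℕ) : K[X] :=
  C ((-1) ^ k / ((b * k + 1 : ℕ) : K)) * hasseDeriv k (A ^ (b * k + 1))

/-- The coefficient of `ε ^ n`, `n > 0`, in `∑ ε ^ k C_k(T + ε A(T) ^ b)` vanishes, where `C_k` is
`lagrangeCoeff A b k`: the series equals `A`. -/
theorem sum_hasseDeriv_lagrangeCoeff (A : K[X]) (b : ℕ) {n : ℕ} (hn : 0 < n) :
    ∑ k ∈ Finset.range (n + 1),
      hasseDeriv (n - k) (lagrangeCoeff A b k) * (A ^ b) ^ (n - k) = 0 := by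
  have key := sum_neg_one_pow_mul_iterate_derivative_eq_zero (A ^ b) (derivative A)
    (Nat.sub_one_lt_of_lt hn)
  have hf : (C (n.factorial : K) : K[X]) ≠ 0 := by
    rw [Ne, C_eq_zero]; exact_mod_cast n.factorial_ne_zero
  refine (mul_eq_zero.1 (?_ : C (n.factorial : K) * _ = 0)).resolve_left hf
  rw [← key, Finset.mul_sum]
  refine Finset.sum_congr rfl fun k hk => ?_
  have hk' : k ≤ n := Nat.lt_succ_iff.1 (Finset.mem_range.1 hk)
  have hc : ((b * k + 1 : ℕ) : K) ≠ 0 := Nat.cast_ne_zero.2 (Nat.succ_ne_zero _)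
  have h1 : hasseDeriv (n - k) (lagrangeCoeff A b k)
      = C ((-1) ^ k / ((b * k + 1 : ℕ) : K)) *
        ((n.choose k : K[X]) * hasseDeriv n (A ^ (b * k + 1))) := by
    have := LinearMap.congr_fun (hasseDeriv_comp (R := K) (n - k) k) (A ^ (b * k + 1))
    rw [LinearMap.comp_apply, Nat.sub_add_cancel hk', Nat.choose_symm hk'] at this
    rw [lagrangeCoeff, ← smul_eq_C_mul, map_smul, this, smul_eq_C_mul]
    simp [nsmul_eq_mul]
  have h2 : C (n.factorial : K) * hasseDeriv n (A ^ (b * k + 1))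
      = C ((b * k + 1 : ℕ) : K) * derivative^[n - 1] (derivative A * (A ^ b) ^ k) := by
    have := congr_fun (factorial_smul_hasseDeriv (R := K) n) (A ^ (b * k + 1))
    rw [LinearMap.smul_apply, nsmul_eq_mul] at this
    rw [map_natCast, this]
    obtain ⟨m, rfl⟩ : ∃ m, n = m + 1 := ⟨n - 1, by omega⟩
    rw [Function.iterate_succ_apply, derivative_pow, ← iterate_derivative_C_mul]
    simp [pow_mul, mul_assoc, mul_comm, mul_left_comm]
  have h3 : (C ((-1) ^ k / ((b * k + 1 : ℕ) : K)) : K[X]) * C ((b * k + 1 : ℕ) : K) = (-1) ^ k := by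
    rw [← C_mul, div_mul_cancel₀ _ hc]; simp
  rw [h1]
  calc _ = C ((-1) ^ k / ((b * k + 1 : ℕ) : K)) * (n.choose k : K[X]) * (A ^ b) ^ (n - k)
        * (C (n.factorial : K) * hasseDeriv n (A ^ (b * k + 1))) := by ring
    _ = (C ((-1) ^ k / ((b * k + 1 : ℕ) : K)) * C ((b * k + 1 : ℕ) : K)) * (n.choose k : K[X])
        * (A ^ b) ^ (n - k) * derivative^[n - 1] (derivative A * (A ^ b) ^ k) := by rw [h2]; ring
    _ = _ := by rw [h3]

/-- Taylor's formula modulo `e ^ M`. -/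
theorem pow_dvd_aeval_add_sub_sum {K B : Type*} [CommRing K] [CommRing B] [Algebra K B] (y e g : B)
    (f : K[X]) (M : ℕ) :
    e ^ M ∣ aeval (y + e * g) f -
      ∑ j ∈ Finset.range M, e ^ j * aeval y (hasseDeriv j f) * g ^ j := by
  have h1 : ∀ j, aeval y (hasseDeriv j f) = (taylor y (f.map (algebraMap K B))).coeff j := by
    intro j
    rw [taylor_coeff, aeval_def, ← eval_map]
    congr 1
    ext n
    simp [hasseDeriv_coeff]
  have h2 : aeval (y + e * g) f = (taylor y (f.map (algebraMap K B))).eval (e * g) := by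
    rw [taylor_eval, aeval_def, ← eval_map, add_comm]
  set q := taylor y (f.map (algebraMap K B))
  rw [h2, eval_eq_sum_range' (show q.natDegree < M + (q.natDegree + 1) by omega),
    Finset.sum_range_add]
  simp only [h1]
  have h3 : ∑ j ∈ Finset.range M, e ^ j * q.coeff j * g ^ j
      = ∑ j ∈ Finset.range M, q.coeff j * (e * g) ^ j :=
    Finset.sum_congr rfl fun j _ => by rw [mul_pow]; ring
  rw [h3, add_sub_cancel_left]
  refine Finset.dvd_sum fun j _ => ?_
  rw [pow_add, mul_pow]
  exact Dvd.intro (g ^ M * (q.coeff (M + j) * (e * g) ^ j)) (by ring)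

/-- Lagrange inversion modulo `e ^ (c + 1)`. -/
theorem pow_dvd_sum_lagrangeCoeff_sub {B : Type*} [CommRing B] [Algebra K B]
    (A : K[X]) (b c : ℕ) (y e : B) :
    e ^ (c + 1) ∣ ∑ k ∈ Finset.range (c + 1),
      e ^ k * aeval (y + e * aeval y A ^ b) (lagrangeCoeff A b k) - aeval y A := by
  have h1 : aeval y A = ∑ k ∈ Finset.range (c + 1), ∑ j ∈ Finset.range (c + 1 - k),
      e ^ k * (e ^ j * aeval y (hasseDeriv j (lagrangeCoeff A b k)) * (aeval y A ^ b) ^ j) := by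
    rw [← Finset.sum_range_diag_flip (c + 1) fun k j =>
      e ^ k * (e ^ j * aeval y (hasseDeriv j (lagrangeCoeff A b k)) * (aeval y A ^ b) ^ j),
      Finset.sum_range_succ']
    rw [Finset.sum_eq_zero]
    · simp [lagrangeCoeff]
    · intro n _
      have h := congrArg (fun p => e ^ (n + 1) * aeval y p)
        (sum_hasseDeriv_lagrangeCoeff A b (Nat.succ_pos n))
      simp only [map_zero, mul_zero, map_sum, Finset.mul_sum] at h
      rw [← h]
      refine Finset.sum_congr rfl fun k hk => ?_
      rw [← mul_assoc, ← mul_assoc, ← pow_add,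
        Nat.add_sub_cancel' (Nat.lt_succ_iff.1 (Finset.mem_range.1 hk))]
      simp only [map_mul, map_pow, mul_assoc, Nat.succ_eq_add_one]
  conv => rhs; rhs; rw [h1]
  rw [← Finset.sum_sub_distrib]
  refine Finset.dvd_sum fun k hk => ?_
  rw [← Finset.mul_sum, ← mul_sub]
  have hk' := Finset.mem_range.1 hk
  rw [show e ^ (c + 1) = e ^ k * e ^ (c + 1 - k) by rw [← pow_add]; congr 1; omega]
  exact mul_dvd_mul_left _ (pow_dvd_aeval_add_sub_sum y e _ _ _)

/-- With `f = e ^ c x + A(y)` and `g = y + e f ^ b`, subtracting from `f` the first `c` terms of the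
Lagrange series at `g`, and a further polynomial `e ^ c D + e ^ (c + 1) T ^ N` at `g`, leaves
`e ^ c (x + C_c(y) - D(y))` modulo `e ^ (c + 1)`. The term `e ^ c x` of `f` is only felt by `g`
modulo `e ^ (c + 1)`, so that `g` may be replaced by `y + e A(y) ^ b` in the series. -/
theorem pow_dvd_sub_sum_lagrangeCoeff {B : Type*} [CommRing B] [Algebra K B]
    (A D : K[X]) (b c N : ℕ) (x y e : B) :
    e ^ (c + 1) ∣ (e ^ c * x + aeval y A)
      - aeval (y + e * (e ^ c * x + aeval y A) ^ b) D * e ^ c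
      - e ^ (c + 1) * (y + e * (e ^ c * x + aeval y A) ^ b) ^ N
      - ∑ k ∈ Finset.range c,
        e ^ k * aeval (y + e * (e ^ c * x + aeval y A) ^ b) (lagrangeCoeff A b k)
      - e ^ c * (x + aeval y (lagrangeCoeff A b c - D)) := by
  set f := e ^ c * x + aeval y A with hf
  set g := y + e * f ^ b with hg
  set g' := y + e * aeval y A ^ b with hg'
  have hgg : e ^ (c + 1) ∣ g - g' := by
    have : f - aeval y A ∣ f ^ b - aeval y A ^ b := sub_dvd_pow_sub_pow _ _ _
    rw [show f - aeval y A = e ^ c * x by rw [hf]; ring] at this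
    rw [show g - g' = e * (f ^ b - aeval y A ^ b) by rw [hg, hg']; ring, pow_succ']
    exact mul_dvd_mul_left _ (dvd_trans (Dvd.intro _ rfl) this)
  have hD : ∀ (u v : B) (p : K[X]), u - v ∣ aeval u p - aeval v p := fun u v p => by
    simp only [aeval_def, ← eval_map]
    exact sub_dvd_eval_sub _ _ _
  have h1 := pow_dvd_sum_lagrangeCoeff_sub A b c y e
  rw [Finset.sum_range_succ, ← hg'] at h1
  have h2 : e ^ (c + 1) ∣ ∑ k ∈ Finset.range c, e ^ k * aeval g (lagrangeCoeff A b k)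
      - ∑ k ∈ Finset.range c, e ^ k * aeval g' (lagrangeCoeff A b k) := by
    rw [← Finset.sum_sub_distrib]
    refine Finset.dvd_sum fun k _ => ?_
    rw [← mul_sub]
    exact Dvd.dvd.mul_left (hgg.trans (hD _ _ _)) _
  have hy : ∀ (u : B) (p : K[X]), e ∣ u - y → e ^ (c + 1) ∣ e ^ c * (aeval u p - aeval y p) :=
    fun u p hu => by rw [pow_succ]; exact mul_dvd_mul_left _ (hu.trans (hD _ _ _))
  have h3 := hy g' (lagrangeCoeff A b c) ⟨_, add_sub_cancel_left _ _⟩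
  have h4 := hy g D ⟨_, add_sub_cancel_left _ _⟩
  have h5 : e ^ (c + 1) ∣ e ^ (c + 1) * g ^ N := Dvd.intro _ rfl
  have := ((((h3.sub h1).sub h2).sub h4).sub h5)
  convert this using 1
  rw [map_sub, hf]
  ring

end Lagrange

/-! ### Approximate roots -/

section Root

open Polynomial

/-- Approximate roots: a polynomial `Q` of degree `a m` agrees in its `a + 1` leading coefficients
with the `m`-th power of a polynomial of degree `a`. The coefficients of the root are found one by
one from the top, each from a linear equation. -/
theorem exists_pow_coeff_eq {K : Type*} [Field K] [CharZero K] [IsAlgClosed K] (Q : K[X])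
    {a m : ℕ} (hm : 0 < m) (hQ : Q.natDegree = a * m) (hQ0 : Q ≠ 0) :
    ∃ A : K[X], A.natDegree = a ∧ ∀ j, a * m ≤ j + a → (A ^ m).coeff j = Q.coeff j := by
  suffices h : ∀ i ≤ a, ∃ A : K[X], A.natDegree ≤ a ∧ A.coeff a ≠ 0 ∧
      ∀ j, a * m ≤ j + i → (A ^ m).coeff j = Q.coeff j by
    obtain ⟨A, h1, h2, h3⟩ := h a le_rfl
    exact ⟨A, natDegree_eq_of_le_of_coeff_ne_zero h1 h2, h3⟩
  intro i
  induction i with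
  | zero =>
    intro _
    obtain ⟨l, hl⟩ := IsAlgClosed.exists_pow_nat_eq Q.leadingCoeff hm
    have hl0 : l ≠ 0 := by
      rintro rfl
      rw [zero_pow hm.ne'] at hl
      exact hQ0 (leadingCoeff_eq_zero.1 hl.symm)
    refine ⟨C l * X ^ a, natDegree_C_mul_X_pow_le l a, by simpa using hl0, fun j hj => ?_⟩
    rw [mul_pow, ← C_pow, ← pow_mul, hl, coeff_C_mul_X_pow]
    split_ifs with h
    · rw [h, ← hQ, coeff_natDegree]
    · rw [coeff_eq_zero_of_natDegree_lt]; omega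
  | succ i ih =>
    intro hi
    obtain ⟨A, h1, h2, h3⟩ := ih (by omega)
    set l := A.coeff a with hl
    have hml : (m : K) * l ^ (m - 1) ≠ 0 :=
      mul_ne_zero (by exact_mod_cast hm.ne') (pow_ne_zero _ h2)
    obtain ⟨s, rfl⟩ : ∃ s, a = s + (i + 1) := ⟨a - (i + 1), by omega⟩
    obtain ⟨n, rfl⟩ : ∃ n, m = n + 1 := ⟨m - 1, by omega⟩
    -- Adding `u X ^ s` to `A` changes the coefficient of `A ^ (n + 1)` in degree
    -- `(s + i + 1) n + s` by `(n + 1) l ^ n u`, and no higher coefficient.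
    set u := (Q.coeff ((s + (i + 1)) * n + s) - (A ^ (n + 1)).coeff ((s + (i + 1)) * n + s))
      / (((n + 1 : ℕ) : K) * l ^ n) with hu
    set A' := A + C u * X ^ s with hA'
    have h1' : A'.natDegree ≤ s + (i + 1) :=
      natDegree_add_le_of_degree_le h1 ((natDegree_C_mul_X_pow_le u s).trans (by omega))
    have hl' : A'.coeff (s + (i + 1)) = l := by
      rw [hA', coeff_add, coeff_C_mul_X_pow, if_neg (by omega), add_zero]
    set W := ∑ k ∈ Finset.range (n + 1), A' ^ k * A ^ (n - k) with hW
    have hterm : ∀ k ∈ Finset.range (n + 1),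
        (A' ^ k * A ^ (n - k)).natDegree ≤ (s + (i + 1)) * n ∧
        (A' ^ k * A ^ (n - k)).coeff ((s + (i + 1)) * n) = l ^ n := by
      intro k hk
      have hk' : k ≤ n := Nat.lt_succ_iff.1 (Finset.mem_range.1 hk)
      have e1 := natDegree_pow_le_of_le k h1'
      have e2 := natDegree_pow_le_of_le (n - k) h1
      have e3 : (s + (i + 1)) * n = k * (s + (i + 1)) + (n - k) * (s + (i + 1)) := by
        rw [← add_mul, Nat.add_sub_cancel' hk', mul_comm]
      rw [e3]
      refine ⟨natDegree_mul_le_of_le e1 e2, ?_⟩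
      rw [coeff_mul_add_eq_of_natDegree_le e1 e2,
        coeff_pow_of_natDegree_le h1', coeff_pow_of_natDegree_le h1, hl', ← hl, ← pow_add,
        Nat.add_sub_cancel' hk']
    have hWd : W.natDegree ≤ (s + (i + 1)) * n :=
      natDegree_sum_le_of_forall_le _ _ fun k hk => (hterm k hk).1
    have hWc : W.coeff ((s + (i + 1)) * n) = ((n + 1 : ℕ) : K) * l ^ n := by
      rw [hW, finsetSum_coeff, Finset.sum_congr rfl fun k hk => (hterm k hk).2]
      simp
    have hdiff : A' ^ (n + 1) = A ^ (n + 1) + C u * W * X ^ s := by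
      have := (Commute.all A' A).geom_sum₂_mul (n + 1)
      rw [show A' - A = C u * X ^ s by rw [hA']; ring] at this
      rw [← sub_eq_iff_eq_add', ← this, hW]
      simp only [Nat.add_sub_cancel]
      ring
    refine ⟨A', h1', by rwa [hl'], fun j hj => ?_⟩
    have hexp : (s + (i + 1)) * (n + 1) = (s + (i + 1)) * n + s + (i + 1) := by ring
    obtain ⟨t, rfl⟩ : ∃ t, j = (s + (i + 1)) * n + t + s :=
      ⟨j - ((s + (i + 1)) * n + s), by omega⟩
    rw [hdiff, coeff_add, coeff_mul_X_pow, coeff_C_mul]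
    rcases Nat.eq_zero_or_pos t with rfl | ht
    · rw [add_zero, hWc, hu, div_mul_cancel₀ _ (by simpa using hml)]
      ring
    · rw [coeff_eq_zero_of_natDegree_lt (by omega : W.natDegree < (s + (i + 1)) * n + t), mul_zero,
        add_zero]
      exact h3 _ (by omega)

/-- The `a + 1` leading coefficients of the `c`-th Lagrange coefficient can be prescribed: the
approximate root is applied to a `c`-fold antiderivative of the given polynomial, which has degree
`c d + a + c = a (b c + 1)`. -/
theorem exists_lagrangeCoeff_coeff_eq {K : Type*} [Field K] [CharZero K] [IsAlgClosed K] (P : K[X])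
    {a b c d : ℕ} (hd : d + 1 = a * b) (hP : P.natDegree = c * d + a) (hP0 : P ≠ 0) :
    ∃ A : K[X], A.natDegree = a ∧
      ∀ j, c * d ≤ j → (lagrangeCoeff A b c).coeff j = P.coeff j := by
  set w : ℕ → K := fun j => (-1) ^ c / ((b * c + 1 : ℕ) : K) * ((j + c).choose c : K) with hw
  have hw0 : ∀ j, w j ≠ 0 := fun j =>
    mul_ne_zero (div_ne_zero (pow_ne_zero _ (by simp)) (Nat.cast_ne_zero.2 (Nat.succ_ne_zero _)))
      (Nat.cast_ne_zero.2 (Nat.choose_pos (by omega)).ne')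
  set Q : K[X] := ∑ j ∈ Finset.range (c * d + a + 1), C (P.coeff j / w j) * X ^ (j + c) with hQ
  have hQc : ∀ j, Q.coeff (j + c) = P.coeff j / w j := by
    intro j
    rw [hQ, finsetSum_coeff]
    simp only [coeff_C_mul_X_pow, add_left_inj]
    rw [Finset.sum_ite_eq]
    split_ifs with h
    · rfl
    · rw [coeff_eq_zero_of_natDegree_lt, zero_div]
      simp at h; omega
  have hexp : a * (b * c + 1) = c * d + a + c := by
    calc a * (b * c + 1) = (a * b) * c + a := by ring
      _ = _ := by rw [← hd]; ring
  have hlead : Q.coeff (c * d + a + c) ≠ 0 := by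
    rw [hQc, ← hP]
    exact div_ne_zero (by simpa using hP0) (hw0 _)
  have hQd : Q.natDegree = a * (b * c + 1) := by
    rw [hexp]
    refine natDegree_eq_of_le_of_coeff_ne_zero
      (natDegree_sum_le_of_forall_le _ _ fun j hj => ?_) hlead
    refine (natDegree_C_mul_X_pow_le _ _).trans ?_
    have := Finset.mem_range.1 hj
    omega
  obtain ⟨A, hA, hAQ⟩ := exists_pow_coeff_eq Q (Nat.succ_pos (b * c)) hQd
    (fun h => hlead (by rw [h, coeff_zero]))
  refine ⟨A, hA, fun j hj => ?_⟩
  rw [lagrangeCoeff, coeff_C_mul, hasseDeriv_coeff,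
    hAQ (j + c) (by simp only [Nat.succ_eq_add_one]; omega), hQc, ← mul_assoc]
  exact mul_div_cancel₀ _ (hw0 j)

theorem natDegree_lagrangeCoeff_le {K : Type*} [Field K] {A : K[X]} {a b d : ℕ} (k : ℕ)
    (hd : d + 1 = a * b) (hA : A.natDegree = a) :
    (lagrangeCoeff A b k).natDegree ≤ k * d + a := by
  refine (natDegree_C_mul_le _ _).trans ((natDegree_hasseDeriv_le _ _).trans ?_)
  rw [natDegree_pow, hA]
  have : (b * k + 1) * a = k * d + a + k := by
    calc (b * k + 1) * a = (a * b) * k + a := by ring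
      _ = _ := by rw [← hd]; ring
  omega

end Root

/-! ### Families of automorphisms and the Zariski closure -/

namespace PlaneAut

open MvPolynomial

/-- The value at the parameter `z` of a polynomial in two variables over `ℂ[ε]`. -/
noncomputable def specialize (z : ℂ) :
    MvPolynomial (Fin 2) (Polynomial ℂ) →ₐ[ℂ] MvPolynomial (Fin 2) ℂ :=
  mapAlgHom (Polynomial.aeval z)

/-- A polynomial in two variables over `ℂ`, as one over `ℂ[ε]` that does not depend on `ε`. -/
noncomputable def constFamily :
    MvPolynomial (Fin 2) ℂ →ₐ[ℂ] MvPolynomial (Fin 2) (Polynomial ℂ) :=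
  mapAlgHom (Algebra.ofId ℂ (Polynomial ℂ))

theorem specialize_constFamily (z : ℂ) (p : MvPolynomial (Fin 2) ℂ) :
    specialize z (constFamily p) = p := by
  have : (specialize z).comp constFamily = AlgHom.id ℂ _ :=
    algHom_ext fun i => by simp [specialize, constFamily]
  exact DFunLike.congr_fun this p

theorem specialize_C_X (z : ℂ) : specialize z (C Polynomial.X) = C z := by
  simp [specialize]

/-- If the members of a polynomial one-parameter family are in `E` for infinitely many parameters,
then the member at `0` is in the closure of `E`: degrees are bounded in the family, and an equation
in the coefficients of its members is a polynomial in the parameter with infinitely many zeros. The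
members of the family need not be automorphisms for the other parameters. -/
theorem mem_closure_of_family {E : Set PlaneAut} {τ : PlaneAut}
    (F : Fin 2 → MvPolynomial (Fin 2) (Polynomial ℂ))
    (h0 : ∀ i, τ.comp i = specialize 0 (F i))
    (hE : {z : ℂ | ∃ σ ∈ E, ∀ i, σ.comp i = specialize z (F i)}.Infinite) :
    τ ∈ closure E := by
  obtain ⟨S, hS⟩ := (isClosed_iff (closure E)).1 isClosed_closure
    (max (F 0).totalDegree (F 1).totalDegree)
  have hdeg : ∀ (σ : PlaneAut) (z : ℂ),
      (∀ i, σ.comp i = specialize z (F i)) →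
        σ.degree ≤ max (F 0).totalDegree (F 1).totalDegree := by
    intro σ z hσ
    rw [degree, hσ, hσ]
    exact max_le_max (Finset.sup_mono (support_map_subset _ _))
      (Finset.sup_mono (support_map_subset _ _))
  have hcoeff : ∀ (σ : PlaneAut) (z : ℂ),
      (∀ i, σ.comp i = specialize z (F i)) →
        ∀ p, eval σ.coeffs p = (aeval (fun m => (F m.1).coeff m.2) p : Polynomial ℂ).eval z := by
    intro σ z hσ p
    rw [← Polynomial.coe_aeval_eq_eval, ← AlgHom.comp_apply, comp_aeval, ← aeval_eq_eval]
    refine congrArg (fun f => aeval f p) (funext fun m => ?_)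
    rw [coeffs, hσ]
    exact coeff_map _ _ _
  rw [hS τ (hdeg τ 0 h0)]
  intro p hp
  rw [hcoeff τ 0 h0, Polynomial.eq_zero_of_infinite_isRoot (aeval _ p) (hE.mono ?_), Polynomial.eval_zero]
  rintro z ⟨σ, hσE, hσ⟩
  rw [Set.mem_ofPred_eq, Polynomial.IsRoot, ← hcoeff σ z hσ]
  exact (hS σ (hdeg σ z hσ)).1 (subset_closure hσE) p hp

/-! ### Triangular automorphisms and the exchange of coordinates -/

/-- The triangular automorphism `(r X + P(Y), s Y + t)`. -/
noncomputable def triangular (r s t : ℂ) (P : Polynomial ℂ) (hr : r ≠ 0) (hs : s ≠ 0) : PlaneAut :=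
  MulOpposite.op <| AlgEquiv.ofAlgHom
    (aeval ![C r * X 0 + Polynomial.aeval (X 1) P, C s * X 1 + C t])
    (aeval ![C r⁻¹ * (X 0 - Polynomial.aeval (C s⁻¹ * (X 1 - C t)) P), C s⁻¹ * (X 1 - C t)])
    (by
      have hr' : (C r⁻¹ : MvPolynomial (Fin 2) ℂ) * C r = 1 := by rw [← C_mul]; simp [hr]
      have hs' : (C s⁻¹ : MvPolynomial (Fin 2) ℂ) * C s = 1 := by rw [← C_mul]; simp [hs]
      refine algHom_ext fun i => ?_
      fin_cases i
      · simp [← Polynomial.aeval_algHom_apply, algebraMap_eq, ← mul_assoc, hr', hs']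
      · simp [algebraMap_eq, ← mul_assoc, hs'])
    (by
      have hr' : (C r : MvPolynomial (Fin 2) ℂ) * C r⁻¹ = 1 := by rw [← C_mul]; simp [hr]
      have hs' : (C s : MvPolynomial (Fin 2) ℂ) * C s⁻¹ = 1 := by rw [← C_mul]; simp [hs]
      refine algHom_ext fun i => ?_
      fin_cases i
      · simp [← Polynomial.aeval_algHom_apply, algebraMap_eq, ← mul_assoc, hr']
      · simp [algebraMap_eq, ← mul_assoc, hs'])

section

variable {r s t : ℂ} {P : Polynomial ℂ} {hr : r ≠ 0} {hs : s ≠ 0}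

theorem triangular_comp_zero :
    (triangular r s t P hr hs).comp 0 = C r * X 0 + Polynomial.aeval (X 1) P := by
  simp [triangular, comp]

theorem triangular_comp_one : (triangular r s t P hr hs).comp 1 = C s * X 1 + C t := by
  simp [triangular, comp]

theorem isTriangular_triangular : (triangular r s t P hr hs).IsTriangular :=
  ⟨r, s, t, P, hr, hs, triangular_comp_zero, triangular_comp_one⟩

end

theorem degree_eq_max_of_triangular {τ : PlaneAut} {r s t : ℂ} {P : Polynomial ℂ} (hr : r ≠ 0)
    (h0 : τ.comp 0 = C r * X 0 + Polynomial.aeval (X 1) P) (h1 : τ.comp 1 = C s * X 1 + C t) :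
    τ.degree = max 1 P.natDegree := by
  -- The coefficients of `Y ^ deg P` and of `X` bound the degree from below.
  have hP : ∀ n, (Polynomial.aeval (X 1 : MvPolynomial (Fin 2) ℂ) P).coeff (Finsupp.single 1 n)
      = P.coeff n := by
    intro n
    rw [Polynomial.aeval_eq_sum_range, coeff_sum]
    simp only [coeff_smul, coeff_X_pow, smul_eq_mul]
    rw [Finset.sum_eq_single n]
    · simp
    · intro k _ hk
      rw [if_neg fun h => hk (Finsupp.single_injective _ h), mul_zero]
    · intro h
      rw [Polynomial.coeff_eq_zero_of_natDegree_lt (by simpa using h), zero_mul]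
  have hP0 : (Polynomial.aeval (X 1 : MvPolynomial (Fin 2) ℂ) P).coeff (Finsupp.single 0 1) = 0 := by
    rw [Polynomial.aeval_eq_sum_range, coeff_sum]
    refine Finset.sum_eq_zero fun k _ => ?_
    rw [coeff_smul, coeff_X_pow, if_neg, smul_zero]
    intro h
    simpa using DFunLike.congr_fun h 0
  have hle : (Polynomial.aeval (X 1 : MvPolynomial (Fin 2) ℂ) P).totalDegree ≤ P.natDegree := by
    rw [Polynomial.aeval_eq_sum_range]
    refine totalDegree_finsetSum_le fun k hk => (totalDegree_smul_le _ _).trans ?_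
    rw [totalDegree_X_pow]
    exact Nat.lt_succ_iff.1 (Finset.mem_range.1 hk)
  have hX : ∀ (u : ℂ) (i : Fin 2), (C u * X i : MvPolynomial (Fin 2) ℂ).totalDegree ≤ 1 :=
    fun u i => (totalDegree_mul _ _).trans (by simp)
  rw [degree, h0, h1]
  apply le_antisymm
  · refine max_le ((totalDegree_add _ _).trans (max_le_max (hX _ _) hle)) ?_
    refine (totalDegree_add _ _).trans (max_le ((hX _ _).trans (le_max_left _ _)) ?_)
    simp
  · refine le_max_of_le_left (max_le ?_ ?_)
    · have := le_totalDegree (p := C r * X 0 + Polynomial.aeval (X 1) P)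
        (s := (Finsupp.single 0 1 : Fin 2 →₀ ℕ)) (by
          rw [mem_support_iff, coeff_add, hP0, coeff_C_mul, coeff_X]; simpa using hr)
      simpa using this
    · rcases Nat.eq_zero_or_pos P.natDegree with h | h
      · rw [h]; exact Nat.zero_le _
      have := le_totalDegree (p := C r * X 0 + Polynomial.aeval (X 1) P)
        (s := (Finsupp.single 1 P.natDegree : Fin 2 →₀ ℕ)) (by
          rw [mem_support_iff, coeff_add, hP, coeff_C_mul, coeff_X, if_neg, mul_zero, zero_add]
          · intro h0; rw [Polynomial.coeff_natDegree, Polynomial.leadingCoeff_eq_zero] at h0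
            simp [h0] at h
          · intro h0
            simpa using DFunLike.congr_fun h0 0)
      simpa using this

theorem degree_triangular {r s t : ℂ} {P : Polynomial ℂ} {hr : r ≠ 0} {hs : s ≠ 0}
    (h : 1 ≤ P.natDegree) : (triangular r s t P hr hs).degree = P.natDegree := by
  rw [degree_eq_max_of_triangular hr triangular_comp_zero triangular_comp_one, max_eq_right h]

theorem isAffine_one : (1 : PlaneAut).IsAffine := by
  have h : ∀ i, (1 : PlaneAut).comp i = X i := fun i => rfl
  simp [IsAffine, degree, h]

/-- The affine automorphism `(Y, X)`. -/
noncomputable def swap : PlaneAut :=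
  MulOpposite.op (renameEquiv ℂ (Equiv.swap (0 : Fin 2) 1))

theorem swap_comp_zero : swap.comp 0 = X 1 := by simp [swap, comp]

theorem swap_comp_one : swap.comp 1 = X 0 := by simp [swap, comp]

theorem isAffine_swap : swap.IsAffine := by
  simp [IsAffine, degree, swap_comp_zero, swap_comp_one]

theorem not_isTriangular_swap : ¬ swap.IsTriangular := by
  rintro ⟨r, s, t, P, hr, hs, -, h⟩
  rw [swap_comp_one] at h
  have h1 := congrArg (eval ![1, 0]) h
  have h2 := congrArg (eval ![0, 0]) h
  simp only [map_add, map_mul, eval_C, eval_X, Matrix.cons_val_zero, Matrix.cons_val_one] at h1 h2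
  exact one_ne_zero (h1.trans h2.symm)

/-! ### The degeneration -/

/-- The automorphism `α₀ β₁ w β₂ w β₃ α₁`, where `w = (Y, X)`, `β₃ = (u X + A(Y), Y)`,
`β₂ = (X + v Y ^ b, Y)` and `β₁ = (r u⁻¹ (X - Q(Y)), s Y + t)`. The polynomials `f` and `g` are the
components that `β₃ α₁` and `β₂ w β₃ α₁` produce. -/
theorem exists_mem_ofPolydegree {A Q : Polynomial ℂ} {b : ℕ} (hA : 2 ≤ A.natDegree) (hb : 2 ≤ b)
    (hQ : 2 ≤ Q.natDegree) {α₀ α₁ : PlaneAut} (h₀ : α₀.IsAffine) (h₁ : α₁.IsAffine)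
    {r s u v : ℂ} (t : ℂ) (hr : r ≠ 0) (hs : s ≠ 0) (hu : u ≠ 0) (hv : v ≠ 0)
    {f g h : MvPolynomial (Fin 2) ℂ}
    (hf : f = C u * α₁.comp 0 + Polynomial.aeval (α₁.comp 1) A)
    (hg : g = α₁.comp 1 + C v * f ^ b) (hh : C u * h = f - Polynomial.aeval g Q) :
    ∃ σ ∈ ofPolydegree [Q.natDegree, b, A.natDegree],
      ∀ i, σ.comp i = aeval ![C r * h, C s * g + C t] (α₀.comp i) := by
  have hru : r * u⁻¹ ≠ 0 := mul_ne_zero hr (inv_ne_zero hu)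
  have hQ' : (Polynomial.C (-(r * u⁻¹)) * Q).natDegree = Q.natDegree :=
    Polynomial.natDegree_C_mul (neg_ne_zero.2 hru)
  have hX : (Polynomial.C v * Polynomial.X ^ b : Polynomial ℂ).natDegree = b :=
    Polynomial.natDegree_C_mul_X_pow _ _ hv
  set β₁ := triangular (r * u⁻¹) s t (Polynomial.C (-(r * u⁻¹)) * Q) hru hs with hβ₁
  set β₂ := triangular 1 1 0 (Polynomial.C v * Polynomial.X ^ b) one_ne_zero one_ne_zero with hβ₂
  set β₃ := triangular u 1 0 A hu one_ne_zero with hβ₃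
  have d₁ : β₁.degree = Q.natDegree := by rw [hβ₁, degree_triangular (by omega), hQ']
  have d₂ : β₂.degree = b := by rw [hβ₂, degree_triangular (by omega), hX]
  have d₃ : β₃.degree = A.natDegree := degree_triangular (by omega)
  refine ⟨α₀ * (β₁ * swap * (β₂ * swap * (β₃ * α₁))), ⟨by simp [hQ, hb, hA], α₀,
    [(β₁, swap), (β₂, swap), (β₃, α₁)], h₀, ?_, ?_, ?_, ?_⟩, ?_⟩
  · simp [hβ₁, hβ₂, hβ₃, isTriangular_triangular, isAffine_swap, h₁]
  · simp [d₁, d₂, d₃]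
  · simp [not_isTriangular_swap]
  · simp
  · intro i
    rw [comp_mul]
    refine congrArg (fun F => aeval F (α₀.comp i)) (funext fun j => ?_)
    have e₁ : (β₃ * α₁).comp 0 = f := by
      simp [comp_mul, hβ₃, triangular_comp_zero, hf, ← Polynomial.aeval_algHom_apply, algebraMap_eq]
    have e₂ : (β₃ * α₁).comp 1 = α₁.comp 1 := by simp [comp_mul, hβ₃, triangular_comp_one]
    have e₃ : (β₂ * swap * (β₃ * α₁)).comp 0 = g := by
      rw [comp_mul, comp_mul]
      simp [hβ₂, triangular_comp_zero, swap_comp_one, swap_comp_zero, e₁, e₂, hg, algebraMap_eq]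
    have e₄ : (β₂ * swap * (β₃ * α₁)).comp 1 = f := by
      rw [comp_mul, comp_mul]
      simp [hβ₂, triangular_comp_one, swap_comp_one, e₁]
    have huC : (C u⁻¹ : MvPolynomial (Fin 2) ℂ) * C u = 1 := by rw [← C_mul]; simp [hu]
    fin_cases j
    · rw [comp_mul, comp_mul]
      simp only [hβ₁, triangular_comp_zero, swap_comp_one, swap_comp_zero, e₃, e₄, algebraMap_eq,
        map_mul, map_add, map_neg, Polynomial.aeval_C, algHom_C, aeval_X,
        ← Polynomial.aeval_algHom_apply, Fin.zero_eta, Matrix.cons_val_zero]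
      linear_combination (- C r * C u⁻¹) * hh + C r * h * huC
    · rw [comp_mul, comp_mul]
      simp [hβ₁, triangular_comp_one, swap_comp_one, e₃, algebraMap_eq]

/-- The coefficient of `T ^ N` is a polynomial in `z` with leading term `z ^ (c + 1)`. -/
theorem finite_setOf_natDegree_ne {N c : ℕ} (D : Polynomial ℂ) (L : ℕ → Polynomial ℂ)
    (hD : D.natDegree ≤ N) (hL : ∀ k < c, (L k).natDegree ≤ N) :
    {z : ℂ | (Polynomial.C (z ^ (c + 1)) * Polynomial.X ^ N + Polynomial.C (z ^ c) * D +
      ∑ k ∈ Finset.range c, Polynomial.C (z ^ k) * L k).natDegree ≠ N}.Finite := by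
  set q : Polynomial ℂ := Polynomial.X ^ (c + 1) + (Polynomial.C (D.coeff N) *
    Polynomial.X ^ c + ∑ k ∈ Finset.range c, Polynomial.C ((L k).coeff N) * Polynomial.X ^ k) with hq
  have hq0 : q ≠ 0 := by
    refine (Polynomial.monic_X_pow_add (lt_of_le_of_lt (b := (c : WithBot ℕ)) ?_
      (by exact_mod_cast Nat.lt_succ_self c))).ne_zero
    refine Polynomial.degree_add_le_of_degree_le (Polynomial.degree_C_mul_X_pow_le _ _)
      ((Polynomial.degree_sum_le _ _).trans (Finset.sup_le fun k hk => ?_))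
    exact (Polynomial.degree_C_mul_X_pow_le _ _).trans
      (by exact_mod_cast (Finset.mem_range.1 hk).le)
  refine (Polynomial.finite_setOfPred_isRoot hq0).subset fun z hz => ?_
  by_contra hqz
  refine hz (Polynomial.natDegree_eq_of_le_of_coeff_ne_zero ?_ ?_)
  · refine Polynomial.natDegree_add_le_of_degree_le (Polynomial.natDegree_add_le_of_degree_le
      (Polynomial.natDegree_C_mul_X_pow_le _ _) ((Polynomial.natDegree_C_mul_le _ _).trans hD))
      (Polynomial.natDegree_sum_le_of_forall_le _ _ fun k hk =>
        (Polynomial.natDegree_C_mul_le _ _).trans (hL k (Finset.mem_range.1 hk)))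
  · intro h0
    refine hqz ?_
    rw [Set.mem_ofPred_eq, Polynomial.IsRoot, ← h0, hq]
    simp only [Polynomial.eval_add, Polynomial.eval_mul, Polynomial.eval_C, Polynomial.eval_pow,
      Polynomial.eval_X, Polynomial.eval_finsetSum, Polynomial.coeff_add, Polynomial.coeff_C_mul,
      Polynomial.finsetSum_coeff, Polynomial.coeff_X_pow_self, mul_one]
    simp only [add_assoc, mul_comm]

/-- The degeneration itself: for `τ = (r (X + P(Y)), s Y + t)` of degree `c d + a`, the automorphism
`α₀ τ α₁` is the limit of a family of automorphisms of polydegree `(c d - 1, b, a)`. -/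
theorem mul_mul_mem_closure {a b c d : ℕ} (ha : 2 ≤ a) (hb : 2 ≤ b) (hc : 1 ≤ c)
    (hd : d + 1 = a * b) {α₀ τ α₁ : PlaneAut} (h₀ : α₀.IsAffine) (hτ : τ.IsTriangular)
    (h₁ : α₁.IsAffine) (hdeg : τ.degree = c * d + a) :
    α₀ * τ * α₁ ∈ closure (ofPolydegree [c * d - 1, b, a]) := by
  obtain ⟨r, s, t, P₀, hr, hs, hτ0, hτ1⟩ := hτ
  have had : a + 1 ≤ d := by nlinarith
  have hcd : d ≤ c * d := Nat.le_mul_of_pos_left d hc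
  obtain ⟨P, rfl⟩ : ∃ P, P₀ = Polynomial.C r * P :=
    ⟨Polynomial.C r⁻¹ * P₀, by rw [← mul_assoc, ← Polynomial.C_mul]; simp [hr]⟩
  have hP : P.natDegree = c * d + a := by
    rw [degree_eq_max_of_triangular hr hτ0 hτ1, Polynomial.natDegree_C_mul hr] at hdeg
    omega
  have hP0 : P ≠ 0 := Polynomial.ne_zero_of_natDegree_gt (n := 0) (by omega)
  -- `A` takes care of the degrees from `c d` to `c d + a` of `P`, and the remainder `D` has degree
  -- at most `c d - 1`, so that the last triangular factor can absorb it.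
  obtain ⟨A, rfl, hAP⟩ := exists_lagrangeCoeff_coeff_eq P hd hP hP0
  set a := A.natDegree with ha_def
  set D := lagrangeCoeff A b c - P with hD
  have hDdeg : D.natDegree ≤ c * d - 1 := by
    rw [Polynomial.natDegree_le_iff_coeff_eq_zero]
    intro j hj
    rw [hD, Polynomial.coeff_sub, hAP j (by omega), sub_self]
  have hLdeg : ∀ k < c, (lagrangeCoeff A b k).natDegree ≤ c * d - 1 := by
    intro k hk
    -- The degree is at most `(c - 1) d + a`, and `a < d`.
    have h1 : (k + 1) * d ≤ c * d := Nat.mul_le_mul_right d hk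
    have h2 := natDegree_lagrangeCoeff_le k hd ha_def.symm
    rw [add_mul] at h1
    omega
  set x := constFamily (α₁.comp 0) with hx
  set y := constFamily (α₁.comp 1) with hy
  set e : MvPolynomial (Fin 2) (Polynomial ℂ) := C Polynomial.X with he
  -- The term `e ^ (c + 1) T ^ (c d - 1)` does not change the limit; it makes the degree of the last
  -- triangular factor equal to `c d - 1` for almost all parameters.
  obtain ⟨w, hw⟩ := pow_dvd_sub_sum_lagrangeCoeff A D b c (c * d - 1) x y e
  rw [hD, sub_sub_cancel, ← hD] at hw
  set f := e ^ c * x + Polynomial.aeval y A with hf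
  set g := y + e * f ^ b with hg
  set h := x + Polynomial.aeval y P + e * w with hh
  have hfac : e ^ c * h = f - Polynomial.aeval g D * e ^ c - e ^ (c + 1) * g ^ (c * d - 1)
      - ∑ k ∈ Finset.range c, e ^ k * Polynomial.aeval g (lagrangeCoeff A b k) := by
    rw [hh]
    linear_combination -hw
  have hcomp : ∀ (z : ℂ) (i : Fin 2),
      specialize z (aeval ![algebraMap ℂ _ r * h, algebraMap ℂ _ s * g + algebraMap ℂ _ t]
        (α₀.comp i)) =
      aeval ![C r * specialize z h, C s * specialize z g + C t] (α₀.comp i) := by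
    intro z i
    rw [← AlgHom.comp_apply, comp_aeval]
    refine congrArg (fun F => aeval F (α₀.comp i)) (funext fun j => ?_)
    fin_cases j <;> simp only [Fin.zero_eta, Fin.mk_one, Matrix.cons_val_zero,
      Matrix.cons_val_one, map_mul, map_add, AlgHom.commutes, algebraMap_eq]
  have hf' : ∀ z, specialize z f = C (z ^ c) * α₁.comp 0 + Polynomial.aeval (α₁.comp 1) A := by
    intro z
    simp only [hf, hx, hy, he, map_add, map_mul, map_pow, specialize_C_X, specialize_constFamily,
      ← Polynomial.aeval_algHom_apply]
  have hg' : ∀ z, specialize z g = α₁.comp 1 + C z * specialize z f ^ b := by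
    intro z
    simp only [hg, hy, he, map_add, map_mul, map_pow, specialize_C_X, specialize_constFamily]
  refine mem_closure_of_family
    (fun i => aeval ![algebraMap ℂ _ r * h, algebraMap ℂ _ s * g + algebraMap ℂ _ t] (α₀.comp i))
    (fun i => ?_) (Set.Infinite.mono (fun z hz => ?_)
    (((finite_setOf_natDegree_ne D (fun k => lagrangeCoeff A b k) hDdeg hLdeg).union
      (Set.finite_singleton 0)).infinite_compl))
  · rw [hcomp, comp_mul, comp_mul, ← AlgHom.comp_apply, comp_aeval]
    refine congrArg (fun F => aeval F (α₀.comp i)) (funext fun j => ?_)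
    fin_cases j
    · simp [hτ0, hh, hx, hy, he, specialize_C_X, specialize_constFamily,
        ← Polynomial.aeval_algHom_apply, algebraMap_eq, mul_add]
    · simp [hτ1, hg', algebraMap_eq]
  · simp only [Set.mem_compl_iff, Set.mem_union, Set.mem_ofPred_eq, Set.mem_singleton_iff, not_or,
      not_not] at hz
    obtain ⟨hQ, hz⟩ := hz
    set Q : Polynomial ℂ := Polynomial.C (z ^ (c + 1)) * Polynomial.X ^ (c * d - 1) +
      Polynomial.C (z ^ c) * D +
      ∑ k ∈ Finset.range c, Polynomial.C (z ^ k) * lagrangeCoeff A b k with hQ_def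
    have hfac' : C (z ^ c) * specialize z h
        = specialize z f - Polynomial.aeval (specialize z g) Q := by
      have := congrArg (specialize z) hfac
      simp only [map_sub, map_mul, map_pow, map_sum, he, specialize_C_X,
        ← Polynomial.aeval_algHom_apply] at this
      rw [C_pow, this, hQ_def]
      simp only [map_add, map_mul, map_pow, map_sum, Polynomial.aeval_C, Polynomial.aeval_X,
        algebraMap_eq]
      ring
    obtain ⟨σ, hσ, hσc⟩ := exists_mem_ofPolydegree ha hb (by omega) h₀ h₁ t hr hs
      (pow_ne_zero c hz) hz (hf' z) (hg' z) hfac'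
    rw [hQ] at hσ
    exact ⟨σ, hσ, fun i => (hσc i).trans (hcomp z i).symm⟩

theorem ofPolydegree_subset_closure {a b c d : ℕ} (ha : 2 ≤ a) (hb : 2 ≤ b) (hc : 1 ≤ c)
    (hd : d + 1 = a * b) :
    ofPolydegree [c * d + a] ⊆ closure (ofPolydegree [c * d - 1, b, a]) := by
  rintro σ ⟨-, α₀, L, h₀, hL, hdeg, -, rfl⟩
  obtain ⟨⟨β, α₁⟩, rfl⟩ : ∃ p, L = [p] :=
    List.length_eq_one_iff.1 (by simpa using congrArg List.length hdeg)
  obtain ⟨hβ, h₁⟩ := hL _ (List.mem_singleton_self _)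
  simpa [mul_assoc] using mul_mul_mem_closure ha hb hc hd h₀ hβ h₁ (by simpa using hdeg)

end PlaneAut

/-- The case `b = 2`, where `d = 2 a - 1`: the degree `c d + a` exceeds by one the bound
`p + q + r - 2` for `(p, q, r) = (c d - 1, 2, a)`. -/
theorem closureLE_and_not_le {a c : ℕ} (ha : 2 ≤ a) (hc : 1 ≤ c) :
    ClosureLE [c * (2 * a - 1) + a] [c * (2 * a - 1) - 1, 2, a] ∧
      2 ≤ c * (2 * a - 1) - 1 ∧
      ¬ c * (2 * a - 1) + a ≤ c * (2 * a - 1) - 1 + 2 + a - 2 := by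
  have h : 2 * a - 1 ≤ c * (2 * a - 1) := Nat.le_mul_of_pos_left _ hc
  exact ⟨PlaneAut.ofPolydegree_subset_closure ha le_rfl hc (by omega), by omega, by omega⟩

theorem mainTheorem1 :
    (∀ a b c d : ℕ, 2 ≤ a → 2 ≤ b → 1 ≤ c → d = a * b - 1 →
      PlaneAut.ofPolydegree [c * d + a] ⊆ closure (PlaneAut.ofPolydegree [c * d - 1, b, a]) ∧
      ∀ τ : PlaneAut, τ.IsTriangular → τ.degree = c * d + a →
        τ ∈ closure (PlaneAut.ofPolydegree [c * d - 1, b, a])) ∧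
    (∀ a c : ℕ, 2 ≤ a → 1 ≤ c →
      ClosureLE [c * (2 * a - 1) + a] [c * (2 * a - 1) - 1, 2, a] ∧
      ¬ FurterLE [c * (2 * a - 1) + a] [c * (2 * a - 1) - 1, 2, a]) ∧
    ¬ (∀ d e : List ℕ, IsDegreeSequence d → IsDegreeSequence e →
        (ClosureLE d e ↔ FurterLE d e)) ∧
    (∀ R : List ℕ → List ℕ → Prop,
      (∀ n p q r : ℕ, 2 ≤ n → 2 ≤ p → 2 ≤ q → 2 ≤ r →
        (R [n] [p, q, r] ↔ n ≤ p + q + r - 2)) →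
      ¬ (∀ d e : List ℕ, IsDegreeSequence d → IsDegreeSequence e →
          (ClosureLE d e ↔ R d e))) := by
  have hR : ∀ R : List ℕ → List ℕ → Prop,
      (∀ n p q r : ℕ, 2 ≤ n → 2 ≤ p → 2 ≤ q → 2 ≤ r →
        (R [n] [p, q, r] ↔ n ≤ p + q + r - 2)) →
      ¬ (∀ d e : List ℕ, IsDegreeSequence d → IsDegreeSequence e →
          (ClosureLE d e ↔ R d e)) := by
    intro R hR h
    have h52 : ClosureLE [5] [2, 2, 2] := (closureLE_and_not_le le_rfl le_rfl).1
    have := (hR 5 2 2 2 (by omega) le_rfl le_rfl le_rfl).1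
      ((h _ _ (by simp [IsDegreeSequence]) (by simp [IsDegreeSequence])).1 h52)
    omega
  have hF := fun n p q r hn hp hq hr => furterLE_triple_iff (n := n) (p := p) (q := q) (r := r)
    hn hp hq hr
  refine ⟨fun a b c d ha hb hc hd => ?_, fun a c ha hc => ?_, hR _ hF, hR⟩
  · have hd' : d + 1 = a * b := by
      have : 0 < a * b := Nat.mul_pos (by omega) (by omega)
      omega
    refine ⟨PlaneAut.ofPolydegree_subset_closure ha hb hc hd', fun τ hτ hdeg => ?_⟩
    simpa using PlaneAut.mul_mul_mem_closure ha hb hc hd' PlaneAut.isAffine_one hτ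
      PlaneAut.isAffine_one hdeg
  · obtain ⟨h1, h2, h3⟩ := closureLE_and_not_le ha hc
    exact ⟨h1, fun h => h3 ((hF _ _ _ _ (by omega) h2 le_rfl ha).1 h)⟩
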